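/- A general Dirichlet series is a series $D(s)=\sum_{n\ge1}a(n)e^{-\lambda(n)s}$ with $a(n)\in\mathbb C$ and $(\lambda(n))_{n\ge1}$ a strictly increasing sequence of nonnegative reals tending to $+\infty$. Put $\sigma_c(D)=\inf\{\operatorname{Re}s:\ \sum_n a(n)e^{-\lambda(n)s}\text{ converges}\}$ and $\sigma_2(D)=\inf\{\sigma\in\mathbb R:\ \sum_n|a(n)|^2e^{-2\lambda(n)\sigma}<\infty\}$, as elements of $[-\infty,+\infty]$. For $\sigma_0\in\mathbb R$, the series $D$ belongs to the class $\mathcal D_{\mathrm{w.a.}}(\sigma_0)$ if $\sigma_c(D)<+\infty$ and 1. $D$ extends holomorphically to $\{\operatorname{Re}s>\sigma_0\}$ (the extension is again denoted by $D$); 2. $\sigma_2(D)\le\sigma_0$; 3. for all $\sigma_1>\sigma_0$ there are $A,B>0$ such that $|D(\sigma+it)|\le A+|t|^B$ for all $\sigma\ge\sigma_1$ and $t\in\mathbb R$; 4. for all $\sigma_2>\sigma_1>\sigma_0$, $\ \displaystyle\sup_{\sigma\in[\sigma_1,\sigma_2]}\ \sup_{T>0}\ \frac1T\int_0^T|D(\sigma+it)|^2\,dt<+\infty$;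 5. the sequence $(\lambda(n))_{n\ge1}$ is $\mathbb Q$-linearly independent. **Theorem.** Let $\sigma_0\in\mathbb R$ and let $D(s)=\sum_{n\ge1}a(n)e^{-\lambda(n)s}$ be a general Dirichlet series such that - $\sigma_2(D)\le\sigma_0$; - $a(n)=\rho(n)e^{i\omega n}$ for all $n\ge1$, for some $\omega\in\mathbb R\setminus2\pi\mathbb Z$; - $\lambda(n)$ and $\rho(n)$ are the values at the integers $n\ge1$ of $\mathcal C^2$ functions $\lambda,\rho:[1,+\infty)\to[0,+\infty)$, with $\lambda$ increasing and tending to $+\infty$, and $\lambda'$ nonincreasing and tending to $0$ at $+\infty$; - for all $\sigma>\sigma_0$, the function $x\mapsto\rho(x)e^{-\lambda(x)\sigma}$ is nonincreasing on $[1,+\infty)$; - the sequence $(\lambda(n))_{n\ge1}$ is $\mathbb Q$-linearly independent. Then $D$ belongs to $\mathcal D_{\mathrm{w.a.}}(\sigma_0)$. -/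

import Mathlib

open Filter Topology

/-- A general Dirichlet series `∑ a(n) exp(-λ(n) s)`, given by its coefficients and its frequency,
a strictly increasing sequence of nonnegative reals tending to infinity. The terms are indexed
from `0`: `coeff n` and `freq n` are the data `a(n+1)` and `λ(n+1)` of a series indexed by
`n ≥ 1`. -/
structure GeneralDirichletSeries where
  coeff : ℕ → ℂ
  freq : ℕ → ℝ
  freq_nonneg : ∀ n, 0 ≤ freq n
  freq_strictMono : StrictMono freq
  freq_tendsto : Tendsto freq atTop atTop

namespace GeneralDirichletSeries

/-- The `N`-th partial sum of the series at `s`. -/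
noncomputable def partialSum (D : GeneralDirichletSeries) (N : ℕ) (s : ℂ) : ℂ :=
  ∑ n ∈ Finset.range N, D.coeff n * Complex.exp (-(D.freq n : ℂ) * s)

/-- The series converges at `s`, possibly conditionally, with sum `l`. -/
def ConvergesTo (D : GeneralDirichletSeries) (s l : ℂ) : Prop :=
  Tendsto (fun N : ℕ => D.partialSum N s) atTop (𝓝 l)

/-- The abscissa of convergence, an extended real number. -/
noncomputable def sigmaC (D : GeneralDirichletSeries) : EReal :=
  sInf {x : EReal | ∃ s : ℂ, (∃ l : ℂ, D.ConvergesTo s l) ∧ x = (s.re : EReal)}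

/-- The abscissa of convergence in mean square, an extended real number. -/
noncomputable def sigmaTwo (D : GeneralDirichletSeries) : EReal :=
  sInf {x : EReal | ∃ σ : ℝ,
    Summable (fun n : ℕ => ‖D.coeff n‖ ^ 2 * Real.exp (-2 * D.freq n * σ)) ∧ x = (σ : EReal)}

/-- `f` is a holomorphic extension of the series to the half-plane `Re s > σ₀`: it is holomorphic
there and it is the sum of the series at every point of this half-plane that lies in the open
half-plane of convergence. If `D.sigmaC < ⊤`, then the values of `f` on `Re s > σ₀` are uniquely
determined. -/
def IsHolomorphicExtension (D : GeneralDirichletSeries) (σ₀ : ℝ) (f : ℂ → ℂ) : Prop :=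
  DifferentiableOn ℂ f {s : ℂ | σ₀ < s.re} ∧
    ∀ s : ℂ, σ₀ < s.re → D.sigmaC < (s.re : EReal) → D.ConvergesTo s (f s)

/-- The class `D_{w.a.}(σ₀)`. The abscissa of convergence is required not to be `+∞`; it may be
`-∞`. -/
def dwa (σ₀ : ℝ) : Set GeneralDirichletSeries :=
  {D | D.sigmaC < ⊤ ∧
    (∃ f : ℂ → ℂ, D.IsHolomorphicExtension σ₀ f ∧
      (∀ σ₁ : ℝ, σ₀ < σ₁ → ∃ A B : ℝ, 0 < A ∧ 0 < B ∧
        ∀ s : ℂ, σ₁ ≤ s.re → ‖f s‖ ≤ A + |s.im| ^ B) ∧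
      (∀ σ₁ σ₂ : ℝ, σ₀ < σ₁ → σ₁ < σ₂ → ∃ C : ℝ, ∀ σ ∈ Set.Icc σ₁ σ₂, ∀ T : ℝ, 0 < T →
        (1 / T) * ∫ t in (0 : ℝ)..T, ‖f ((σ : ℂ) + (t : ℂ) * Complex.I)‖ ^ 2 ≤ C)) ∧
    D.sigmaTwo ≤ (σ₀ : EReal) ∧
    LinearIndependent ℚ D.freq}

end GeneralDirichletSeries

/-!
For a fixed `s = σ + it` with `σ > σ₀`, the `n`-th term of the series is
`g(n) exp(i(ω(n+1) - t λ(n)))`, where the amplitude `g(n) = ρ(n) exp(-λ(n) σ)` decreases to `0`.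
Everything comes from two ways of summing this by parts.

*Convergence and growth.* The partial sums of `exp(iωn)` are bounded because `exp(iω) ≠ 1`, and
`n ↦ ρ(n) exp(-λ(n) s)` has total variation `O(1 + |t|)`: comparing `g` with the amplitude at an
abscissa `σ'` strictly between `σ₀` and `σ` gives `g(n) ≤ G exp(-ε λ(n))`, and the increments
`g(n+1) (λ(n+1) - λ(n))` are then dominated by those of `-(G / ε) exp(-ε λ)`. So the remainder after
`M` terms is at most `K (1 + |t| / ε) exp(-ε λ(M))`, uniformly in each half-plane
`Re s ≥ σ₁ > σ₀` (`norm_partialSum_add_sub_le`). The series therefore converges locally uniformly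
on `Re s > σ₀`; its sum is holomorphic there and grows at most linearly in `|t|`.

*Mean square.* Given `T > 0`, the series is cut at the first `N` with
`T (λ(N+1) - λ(N)) ≤ δ := |exp(iω) - 1| / 2`; such an `N` exists because the gaps of `λ` tend to
`0`. After `N`, for `0 ≤ t ≤ T`, the increments of the phase are monotone and stay away from
`2πℤ`, so that the exponential sums are bounded as in the Kusmin-Landau inequality
(`norm_sum_range_exp_le`), and the remainder is bounded independently of `t` and `T`
(`norm_partialSum_add_sub_le_of_mul_gap_le`). Before `N` the frequencies are separated by
`δ / T`, since the gaps decrease; weighting by a Gaussian of width `T` and applying Schur's test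
to the resulting matrix bounds the mean square by a constant times `∑ g(n)²`
(`intervalIntegral_norm_sq_exp_sum_le`), which is finite because `σ₂(D) ≤ σ₀ < σ`.
-/

/-! ### Summation by parts and exponential sums -/

theorem sum_range_mul_eq_abel (u b : ℕ → ℂ) (n : ℕ) :
    ∑ k ∈ Finset.range n, u k * b k =
      (∑ k ∈ Finset.range n, u k) * b n -
        ∑ k ∈ Finset.range n, (∑ j ∈ Finset.range (k + 1), u j) * (b (k + 1) - b k) := by
  induction n with
  | zero => simp
  | succ n ih =>
    rw [Finset.sum_range_succ, ih, Finset.sum_range_succ (fun k => _ * (b (k + 1) - b k)),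
      Finset.sum_range_succ u]
    ring

theorem norm_sum_range_mul_le_of_bounded {u b : ℕ → ℂ} {C : ℝ}
    (hC : ∀ n, ‖∑ k ∈ Finset.range n, u k‖ ≤ C) (n : ℕ) :
    ‖∑ k ∈ Finset.range n, u k * b k‖ ≤
      C * (‖b n‖ + ∑ k ∈ Finset.range n, ‖b (k + 1) - b k‖) := by
  rw [sum_range_mul_eq_abel, mul_add, Finset.mul_sum]
  refine (norm_sub_le _ _).trans (add_le_add ?_ ((norm_sum_le _ _).trans ?_))
  · rw [norm_mul]
    exact mul_le_mul_of_nonneg_right (hC n) (norm_nonneg _)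
  · refine Finset.sum_le_sum fun k _ => ?_
    rw [norm_mul]
    exact mul_le_mul_of_nonneg_right (hC _) (norm_nonneg _)

theorem norm_geom_sum_le_of_norm_eq_one {z : ℂ} (hz : ‖z‖ = 1) (hz1 : z ≠ 1) (n : ℕ) :
    ‖∑ k ∈ Finset.range n, z ^ k‖ ≤ 2 / ‖z - 1‖ := by
  rw [geom_sum_eq hz1, norm_div]
  gcongr
  calc ‖z ^ n - 1‖ ≤ ‖z ^ n‖ + ‖(1 : ℂ)‖ := norm_sub_le _ _
    _ = 2 := by rw [norm_pow, hz]; norm_num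

theorem norm_exp_I_mul_sub_exp_I_mul_le (x y : ℝ) :
    ‖Complex.exp (Complex.I * x) - Complex.exp (Complex.I * y)‖ ≤ |x - y| := by
  have h : Complex.exp (Complex.I * x) - Complex.exp (Complex.I * y) =
      Complex.exp (Complex.I * y) * (Complex.exp (Complex.I * ((x - y : ℝ) : ℂ)) - 1) := by
    rw [mul_sub, ← Complex.exp_add]
    push_cast
    ring_nf
  rw [h, norm_mul, Complex.norm_exp_I_mul_ofReal, one_mul]
  exact Real.norm_exp_I_mul_ofReal_sub_one_le

/-- A discrete Kusmin-Landau inequality: the sum of `exp(i φ(k))` is bounded as soon as the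
increments of `φ` are monotone, of bounded range, and away from `2πℤ`. The bound comes from writing
`exp(i φ(k))` as `exp(i φ(k+1)) - exp(i φ(k))` divided by `exp(i (φ(k+1) - φ(k))) - 1` and
summing by parts; the variation of the denominators' inverses telescopes by monotonicity. -/
theorem norm_sum_range_exp_le {φ : ℕ → ℝ} {d R : ℝ} (hd : 0 < d)
    (hlow : ∀ n, d ≤ ‖Complex.exp (Complex.I * ((φ (n + 1) - φ n : ℝ) : ℂ)) - 1‖)
    (hmono : Monotone fun n => φ (n + 1) - φ n)
    (hR : ∀ n, (φ (n + 1) - φ n) - (φ 1 - φ 0) ≤ R) (n : ℕ) :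
    ‖∑ k ∈ Finset.range n, Complex.exp (Complex.I * φ k)‖ ≤ 2 * (1 / d + R / d ^ 2) := by
  set w : ℕ → ℂ := fun k => Complex.exp (Complex.I * ((φ (k + 1) - φ k : ℝ) : ℂ)) - 1 with hw
  have hw0 : ∀ k, w k ≠ 0 := fun k => norm_pos_iff.1 (hd.trans_le (hlow k))
  have hterm : ∀ k, Complex.exp (Complex.I * φ k) =
      (Complex.exp (Complex.I * φ (k + 1)) - Complex.exp (Complex.I * φ k)) * (w k)⁻¹ := by
    intro k
    rw [eq_mul_inv_iff_mul_eq₀ (hw0 k), hw]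
    simp only
    rw [mul_sub, ← Complex.exp_add]
    push_cast
    ring_nf
  have hdiff : ∀ k, ‖(w (k + 1))⁻¹ - (w k)⁻¹‖ ≤
      ((φ (k + 1 + 1) - φ (k + 1)) - (φ (k + 1) - φ k)) / d ^ 2 := by
    intro k
    rw [inv_sub_inv (hw0 _) (hw0 _), norm_div, norm_mul, pow_two]
    have h1 : ‖w k - w (k + 1)‖ ≤ (φ (k + 1 + 1) - φ (k + 1)) - (φ (k + 1) - φ k) := by
      have h2 := norm_exp_I_mul_sub_exp_I_mul_le (φ (k + 1) - φ k) (φ (k + 1 + 1) - φ (k + 1))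
      have h3 : φ (k + 1) - φ k ≤ φ (k + 1 + 1) - φ (k + 1) := hmono (Nat.le_succ k)
      rw [abs_sub_comm, abs_of_nonneg (by linarith)] at h2
      simpa [hw] using h2
    have h4 : 0 ≤ (φ (k + 1 + 1) - φ (k + 1)) - (φ (k + 1) - φ k) := (norm_nonneg _).trans h1
    exact div_le_div₀ h4 h1 (by positivity)
      (mul_le_mul (hlow _) (hlow _) hd.le (norm_nonneg _))
  have htel : ∀ n, ‖∑ k ∈ Finset.range n,
      (Complex.exp (Complex.I * φ (k + 1)) - Complex.exp (Complex.I * φ k))‖ ≤ 2 := by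
    intro n
    rw [Finset.sum_range_sub (fun k => Complex.exp (Complex.I * φ k))]
    refine (norm_sub_le _ _).trans ?_
    rw [Complex.norm_exp_I_mul_ofReal, Complex.norm_exp_I_mul_ofReal]
    norm_num
  rw [Finset.sum_congr rfl fun k _ => hterm k]
  refine (norm_sum_range_mul_le_of_bounded htel n).trans ?_
  refine mul_le_mul_of_nonneg_left (add_le_add ?_ ?_) zero_le_two
  · rw [norm_inv, ← one_div]
    exact one_div_le_one_div_of_le hd (hlow n)
  · refine (Finset.sum_le_sum fun k _ => hdiff k).trans ?_
    rw [← Finset.sum_div, Finset.sum_range_sub (fun k => φ (k + 1) - φ k)]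
    gcongr
    exact hR n

/-! ### Mean squares of exponential polynomials with separated frequencies -/

theorem geom_sum_le_inv {r : ℝ} (hr0 : 0 ≤ r) (hr1 : r < 1) (n : ℕ) :
    ∑ k ∈ Finset.range n, r ^ k ≤ (1 - r)⁻¹ := by
  rw [← tsum_geometric_of_lt_one hr0 hr1]
  exact (summable_geometric_of_lt_one hr0 hr1).sum_le_tsum _ fun k _ => pow_nonneg hr0 k

theorem sum_range_pow_dist_le {r : ℝ} (hr0 : 0 ≤ r) (hr1 : r < 1) {n N : ℕ} (hn : n < N) :
    ∑ m ∈ Finset.range N, r ^ Nat.dist m n ≤ 2 * (1 - r)⁻¹ := by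
  obtain ⟨j, rfl⟩ := Nat.exists_eq_add_of_le hn.le
  rw [Finset.sum_range_add, two_mul]
  refine add_le_add ?_ ?_
  · rw [← Finset.sum_range_reflect]
    refine (Finset.sum_le_sum fun m hm => ?_).trans (geom_sum_le_inv hr0 hr1 n)
    rw [Finset.mem_range] at hm
    rw [Nat.dist_eq_sub_of_le (by omega)]
    exact pow_le_pow_of_le_one hr0 hr1.le (by omega)
  · refine (Finset.sum_le_sum fun m hm => ?_).trans (geom_sum_le_inv hr0 hr1 j)
    rw [Nat.dist_eq_sub_of_le_right (by omega)]
    simp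

/-- Schur's test for the matrix `r ^ |m - n|`. -/
theorem sum_sum_mul_pow_dist_le {r : ℝ} (hr0 : 0 ≤ r) (hr1 : r < 1) (c : ℕ → ℝ) (N : ℕ) :
    ∑ m ∈ Finset.range N, ∑ n ∈ Finset.range N, c m * c n * r ^ Nat.dist m n ≤
      2 * (1 - r)⁻¹ * ∑ n ∈ Finset.range N, c n ^ 2 := by
  have h1 : ∀ m n, c m * c n * r ^ Nat.dist m n ≤
      c m ^ 2 * r ^ Nat.dist n m / 2 + c n ^ 2 * r ^ Nat.dist m n / 2 := by
    intro m n
    rw [Nat.dist_comm n m]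
    nlinarith [mul_nonneg (sq_nonneg (c m - c n)) (pow_nonneg hr0 (Nat.dist m n))]
  have h2 : ∑ m ∈ Finset.range N, ∑ n ∈ Finset.range N, c n ^ 2 * r ^ Nat.dist m n / 2 ≤
      (1 - r)⁻¹ * ∑ n ∈ Finset.range N, c n ^ 2 := by
    rw [Finset.sum_comm, Finset.mul_sum]
    refine Finset.sum_le_sum fun n hn => ?_
    rw [← Finset.sum_div, ← Finset.mul_sum]
    have := mul_le_mul_of_nonneg_left
      (sum_range_pow_dist_le hr0 hr1 (Finset.mem_range.1 hn)) (sq_nonneg (c n))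
    linarith
  calc _ ≤ ∑ m ∈ Finset.range N, ∑ n ∈ Finset.range N,
        (c m ^ 2 * r ^ Nat.dist n m / 2 + c n ^ 2 * r ^ Nat.dist m n / 2) :=
        Finset.sum_le_sum fun m _ => Finset.sum_le_sum fun n _ => h1 m n
    _ = ∑ m ∈ Finset.range N, ∑ n ∈ Finset.range N, c n ^ 2 * r ^ Nat.dist m n / 2 +
        ∑ m ∈ Finset.range N, ∑ n ∈ Finset.range N, c n ^ 2 * r ^ Nat.dist m n / 2 := by
        simp only [Finset.sum_add_distrib]
        rw [Finset.sum_comm]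
    _ ≤ _ := by linarith

theorem norm_integral_exp_mul_gaussian {T : ℝ} (hT : 0 < T) (u : ℝ) :
    ‖∫ t : ℝ, Complex.exp (Complex.I * u * t) * Complex.exp (-((T⁻¹ ^ 2 : ℝ) : ℂ) * t ^ 2)‖ =
      √Real.pi * T * Real.exp (-(T * u) ^ 2 / 4) := by
  rw [fourierIntegral_gaussian (by rw [Complex.ofReal_re]; positivity), norm_mul, Complex.norm_exp]
  congr 1
  · rw [← Complex.ofReal_div, show (1 / 2 : ℂ) = ((1 / 2 : ℝ) : ℂ) by norm_num,
      Complex.norm_cpow_eq_rpow_re_of_pos (by positivity), Complex.ofReal_re,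
      ← Real.sqrt_eq_rpow, Real.sqrt_div' _ (by positivity), Real.sqrt_sq (by positivity)]
    field_simp
  · congr 1
    rw [show -(u : ℂ) ^ 2 / (4 * ((T⁻¹ ^ 2 : ℝ) : ℂ)) = ((-(T * u) ^ 2 / 4 : ℝ) : ℂ) by
      push_cast
      field_simp, Complex.ofReal_re]

theorem integrable_exp_mul_gaussian {b : ℝ} (hb : 0 < b) (u : ℝ) :
    MeasureTheory.Integrable fun t : ℝ =>
      Complex.exp (Complex.I * u * t) * Complex.exp (-(b : ℂ) * t ^ 2) := by
  have h := integrable_cexp_quadratic' (b := -(b : ℂ)) (by simpa using hb) (Complex.I * u) 0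
  refine h.congr (Eventually.of_forall fun t => ?_)
  simp only
  rw [← Complex.exp_add]
  ring_nf

/-- A mean value inequality of large sieve type: if the frequencies are separated by `δ / T`, then
the mean square of an exponential polynomial over `[0, T]` is at most a constant depending only on
`δ` times the sum of the squares of its coefficients. -/
theorem intervalIntegral_norm_sq_exp_sum_le {c μ : ℕ → ℝ} {δ T : ℝ} {N : ℕ}
    (hδ : 0 < δ) (hT : 0 < T) (hc : ∀ n, 0 ≤ c n) {a : ℕ → ℂ} (ha : ∀ n, ‖a n‖ ≤ c n)
    (hμ : ∀ m < N, ∀ n < N, δ * Nat.dist m n ≤ T * |μ m - μ n|) :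
    ∫ t in (0 : ℝ)..T, ‖∑ n ∈ Finset.range N, a n * Complex.exp (Complex.I * μ n * t)‖ ^ 2 ≤
      Real.exp 1 * (√Real.pi * T *
        (2 * (1 - Real.exp (-δ ^ 2 / 4))⁻¹ * ∑ n ∈ Finset.range N, c n ^ 2)) := by
  set S : ℝ → ℂ := fun t => ∑ n ∈ Finset.range N, a n * Complex.exp (Complex.I * μ n * t) with hS
  set b : ℝ := T⁻¹ ^ 2 with hb
  have hb0 : 0 < b := by positivity
  have hr1 : Real.exp (-δ ^ 2 / 4) < 1 := Real.exp_lt_one_iff.2 (by nlinarith [pow_pos hδ 2])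
  have hScont : Continuous S := by fun_prop
  have hexpand : ∀ t : ℝ, ((Real.exp (-b * t ^ 2) * ‖S t‖ ^ 2 : ℝ) : ℂ) =
      ∑ m ∈ Finset.range N, ∑ n ∈ Finset.range N, a m * starRingEnd ℂ (a n) *
        (Complex.exp (Complex.I * ((μ m - μ n : ℝ) : ℂ) * t) *
          Complex.exp (-(b : ℂ) * t ^ 2)) := by
    intro t
    have h1 : ((‖S t‖ ^ 2 : ℝ) : ℂ) = S t * starRingEnd ℂ (S t) := by
      rw [Complex.mul_conj, Complex.normSq_eq_norm_sq]
    rw [Complex.ofReal_mul, h1, hS]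
    simp only
    rw [map_sum, Finset.sum_mul_sum, Finset.mul_sum]
    refine Finset.sum_congr rfl fun m _ => ?_
    rw [Finset.mul_sum]
    refine Finset.sum_congr rfl fun n _ => ?_
    rw [map_mul, ← Complex.exp_conj]
    have h2 : Complex.exp (Complex.I * ((μ m - μ n : ℝ) : ℂ) * t) =
        Complex.exp (Complex.I * μ m * t) *
          Complex.exp (starRingEnd ℂ (Complex.I * μ n * t)) := by
      rw [← Complex.exp_add]
      simp only [map_mul, Complex.conj_I, Complex.conj_ofReal]
      push_cast
      ring_nf
    rw [h2]
    push_cast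
    ring
  have hint1 : ∀ m n, MeasureTheory.Integrable fun t : ℝ => a m * starRingEnd ℂ (a n) *
        (Complex.exp (Complex.I * ((μ m - μ n : ℝ) : ℂ) * t) *
          Complex.exp (-(b : ℂ) * t ^ 2)) :=
    fun m n => (integrable_exp_mul_gaussian hb0 _).const_mul _
  have hint : MeasureTheory.Integrable fun t : ℝ => Real.exp (-b * t ^ 2) * ‖S t‖ ^ 2 := by
    have : MeasureTheory.Integrable
        fun t : ℝ => ((Real.exp (-b * t ^ 2) * ‖S t‖ ^ 2 : ℝ) : ℂ) := by
      simp only [hexpand]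
      exact MeasureTheory.integrable_finsetSum _ fun m _ =>
        MeasureTheory.integrable_finsetSum _ fun n _ => hint1 m n
    have h := this.re
    simpa only [RCLike.re_eq_complex_re, Complex.ofReal_re] using h
  have hgauss : ∫ t : ℝ, Real.exp (-b * t ^ 2) * ‖S t‖ ^ 2 ≤ √Real.pi * T *
        (2 * (1 - Real.exp (-δ ^ 2 / 4))⁻¹ * ∑ n ∈ Finset.range N, c n ^ 2) := by
    have h1 : ∫ t : ℝ, Real.exp (-b * t ^ 2) * ‖S t‖ ^ 2 ≤
        ‖∫ t : ℝ, ((Real.exp (-b * t ^ 2) * ‖S t‖ ^ 2 : ℝ) : ℂ)‖ := by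
      rw [integral_complex_ofReal, Complex.norm_real]
      exact Real.le_norm_self _
    refine h1.trans ?_
    simp only [hexpand]
    rw [MeasureTheory.integral_finsetSum _ fun m _ =>
      MeasureTheory.integrable_finsetSum _ fun n _ => hint1 m n]
    refine (norm_sum_le _ _).trans (le_trans ?_ (mul_le_mul_of_nonneg_left
      (sum_sum_mul_pow_dist_le (Real.exp_nonneg _) hr1 c N) (by positivity)))
    rw [Finset.mul_sum]
    refine Finset.sum_le_sum fun m hm => ?_
    rw [MeasureTheory.integral_finsetSum _ fun n _ => hint1 m n]
    refine (norm_sum_le _ _).trans ?_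
    rw [Finset.mul_sum]
    refine Finset.sum_le_sum fun n hn => ?_
    rw [MeasureTheory.integral_const_mul, norm_mul, norm_mul, hb,
      norm_integral_exp_mul_gaussian hT, RCLike.norm_conj, ← Real.exp_nat_mul]
    have h3 : Real.exp (-(T * (μ m - μ n)) ^ 2 / 4) ≤
        Real.exp ((Nat.dist m n : ℕ) * (-δ ^ 2 / 4)) := by
      rw [Real.exp_le_exp]
      have h4 := hμ m (Finset.mem_range.1 hm) n (Finset.mem_range.1 hn)
      have h5 : (δ * Nat.dist m n) ^ 2 ≤ (T * (μ m - μ n)) ^ 2 := by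
        rw [mul_pow T, ← sq_abs (μ m - μ n), ← mul_pow]
        exact pow_le_pow_left₀ (by positivity) h4 2
      have h6 : ((Nat.dist m n : ℕ) : ℝ) ≤ (Nat.dist m n : ℕ) ^ 2 := by
        exact_mod_cast Nat.le_self_pow two_ne_zero _
      nlinarith [mul_le_mul_of_nonneg_left h6 (sq_nonneg δ)]
    calc ‖a m‖ * ‖a n‖ * (√Real.pi * T * Real.exp (-(T * (μ m - μ n)) ^ 2 / 4))
        ≤ c m * c n * (√Real.pi * T * Real.exp ((Nat.dist m n : ℕ) * (-δ ^ 2 / 4))) := by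
          gcongr
          · exact mul_nonneg (hc m) (hc n)
          · exact hc m
          · exact ha m
          · exact ha n
      _ = _ := by ring
  -- On `[0, T]` the weight `exp (-(t / T) ^ 2)` is at least `exp (-1)`.
  calc ∫ t in (0 : ℝ)..T, ‖S t‖ ^ 2
      ≤ ∫ t in (0 : ℝ)..T, Real.exp 1 * (Real.exp (-b * t ^ 2) * ‖S t‖ ^ 2) := by
        refine intervalIntegral.integral_mono_on hT.le
          (Continuous.intervalIntegrable (by fun_prop) _ _)
          (Continuous.intervalIntegrable (by fun_prop) _ _) fun t ht => ?_
        rw [← mul_assoc, ← Real.exp_add]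
        refine le_mul_of_one_le_left (sq_nonneg _) (Real.one_le_exp ?_)
        have : T⁻¹ * t ≤ 1 := by
          rw [inv_mul_le_iff₀ hT, mul_one]
          exact ht.2
        have h0 : 0 ≤ T⁻¹ * t := mul_nonneg (by positivity) ht.1
        have : (T⁻¹ * t) ^ 2 ≤ 1 := pow_le_one₀ h0 this
        rw [hb]
        nlinarith
    _ = Real.exp 1 * ∫ t in (0 : ℝ)..T, Real.exp (-b * t ^ 2) * ‖S t‖ ^ 2 :=
        intervalIntegral.integral_const_mul _ _
    _ ≤ Real.exp 1 * ∫ t : ℝ, Real.exp (-b * t ^ 2) * ‖S t‖ ^ 2 := by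
        rw [intervalIntegral.integral_of_le hT.le]
        exact mul_le_mul_of_nonneg_left (MeasureTheory.setIntegral_le_integral hint
          (Eventually.of_forall fun t => by positivity)) (Real.exp_nonneg _)
    _ ≤ _ := mul_le_mul_of_nonneg_left hgauss (Real.exp_nonneg _)

namespace GeneralDirichletSeries

variable {D : GeneralDirichletSeries} {ρ : ℕ → ℝ} {ω σ₀ : ℝ}

/-! ### Convergence, holomorphy and growth -/

theorem ConvergesTo.norm_sub_partialSum_le {s l : ℂ} (h : D.ConvergesTo s l) {M : ℕ} {C : ℝ}
    (hC : ∀ n, ‖D.partialSum (M + n) s - D.partialSum M s‖ ≤ C) :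
    ‖l - D.partialSum M s‖ ≤ C := by
  refine le_of_tendsto (h.sub_const _).norm ?_
  filter_upwards [eventually_ge_atTop M] with N hN
  obtain ⟨n, rfl⟩ := Nat.exists_eq_add_of_le hN
  exact hC n

theorem differentiable_partialSum (D : GeneralDirichletSeries) (N : ℕ) :
    Differentiable ℂ (D.partialSum N) := by
  unfold partialSum
  fun_prop

theorem partialSum_add_sub (D : GeneralDirichletSeries) (M n : ℕ) (s : ℂ) :
    D.partialSum (M + n) s - D.partialSum M s =
      ∑ k ∈ Finset.range n, D.coeff (M + k) * Complex.exp (-(D.freq (M + k) : ℂ) * s) := by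
  rw [partialSum, partialSum, Finset.sum_range_add, add_sub_cancel_left]

theorem exp_neg_freq_mul (D : GeneralDirichletSeries) (k : ℕ) (s : ℂ) :
    Complex.exp (-(D.freq k : ℂ) * s) =
      (Real.exp (-D.freq k * s.re) : ℂ) *
        Complex.exp (Complex.I * ((-(s.im * D.freq k) : ℝ) : ℂ)) := by
  rw [Complex.ofReal_exp, ← Complex.exp_add]
  congr 1
  conv_lhs => rw [← Complex.re_add_im s]
  push_cast
  ring

theorem mul_exp_le_of_add_le (hρ : ∀ n, 0 ≤ ρ n) {σ' ε σ : ℝ}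
    (hanti : Antitone fun n => ρ n * Real.exp (-D.freq n * σ')) (hσ : σ' + ε ≤ σ) (k : ℕ) :
    ρ k * Real.exp (-D.freq k * σ) ≤
      ρ 0 * Real.exp (-D.freq 0 * σ') * Real.exp (-ε * D.freq k) := by
  calc ρ k * Real.exp (-D.freq k * σ)
      ≤ ρ k * Real.exp (-D.freq k * σ' + -ε * D.freq k) := by
        refine mul_le_mul_of_nonneg_left (Real.exp_le_exp.2 ?_) (hρ k)
        nlinarith [mul_le_mul_of_nonneg_left hσ (D.freq_nonneg k)]
    _ = ρ k * Real.exp (-D.freq k * σ') * Real.exp (-ε * D.freq k) := by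
        rw [Real.exp_add, mul_assoc]
    _ ≤ _ := mul_le_mul_of_nonneg_right (hanti (Nat.zero_le k)) (Real.exp_nonneg _)

/-- Comparison of a Riemann sum of `exp(-ε y)` over the frequencies with the integral. -/
theorem exp_mul_freq_sub_le (D : GeneralDirichletSeries) {ε : ℝ} (hε : 0 < ε) (k : ℕ) :
    Real.exp (-ε * D.freq (k + 1)) * (D.freq (k + 1) - D.freq k) ≤
      (Real.exp (-ε * D.freq k) - Real.exp (-ε * D.freq (k + 1))) / ε := by
  rw [le_div_iff₀ hε]
  have h1 : Real.exp (-ε * D.freq k) = Real.exp (-ε * D.freq (k + 1)) *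
      Real.exp (ε * (D.freq (k + 1) - D.freq k)) := by
    rw [← Real.exp_add]
    ring_nf
  have h2 := mul_le_mul_of_nonneg_left
    (Real.add_one_le_exp (ε * (D.freq (k + 1) - D.freq k)))
    (Real.exp_nonneg (-ε * D.freq (k + 1)))
  rw [h1]
  linarith

theorem norm_term_succ_sub_le (hρ : ∀ n, 0 ≤ ρ n) {σ' ε : ℝ} {s : ℂ} (hε : 0 < ε)
    (hanti' : Antitone fun n => ρ n * Real.exp (-D.freq n * σ'))
    (hanti : Antitone fun n => ρ n * Real.exp (-D.freq n * s.re)) (hs : σ' + ε ≤ s.re) (k : ℕ) :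
    ‖(ρ (k + 1) : ℂ) * Complex.exp (-(D.freq (k + 1) : ℂ) * s) -
        ρ k * Complex.exp (-(D.freq k : ℂ) * s)‖ ≤
      (ρ k * Real.exp (-D.freq k * s.re) - ρ (k + 1) * Real.exp (-D.freq (k + 1) * s.re)) +
        |s.im| * (ρ 0 * Real.exp (-D.freq 0 * σ')) / ε *
          (Real.exp (-ε * D.freq k) - Real.exp (-ε * D.freq (k + 1))) := by
  rw [exp_neg_freq_mul, exp_neg_freq_mul]
  set g : ℕ → ℝ := fun n => ρ n * Real.exp (-D.freq n * s.re) with hg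
  set e : ℕ → ℂ := fun n => Complex.exp (Complex.I * ((-(s.im * D.freq n) : ℝ) : ℂ)) with he
  have hsplit : (ρ (k + 1) : ℂ) * ((Real.exp (-D.freq (k + 1) * s.re) : ℂ) * e (k + 1)) -
      ρ k * ((Real.exp (-D.freq k * s.re) : ℂ) * e k) =
      ((g (k + 1) - g k : ℝ) : ℂ) * e k + (g (k + 1) : ℂ) * (e (k + 1) - e k) := by
    simp only [hg]
    push_cast
    ring
  rw [hsplit]
  have hg0 : 0 ≤ g (k + 1) := mul_nonneg (hρ _) (Real.exp_nonneg _)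
  have hfreq : 0 ≤ D.freq (k + 1) - D.freq k :=
    sub_nonneg.2 (D.freq_strictMono.monotone (Nat.le_succ k))
  have hstep : ‖e (k + 1) - e k‖ ≤ |s.im| * (D.freq (k + 1) - D.freq k) := by
    refine (norm_exp_I_mul_sub_exp_I_mul_le _ _).trans_eq ?_
    rw [show -(s.im * D.freq (k + 1)) - -(s.im * D.freq k) =
      -(s.im * (D.freq (k + 1) - D.freq k)) by ring, abs_neg, abs_mul, abs_of_nonneg hfreq]
  refine (norm_add_le _ _).trans (add_le_add ?_ ?_)
  · rw [norm_mul, he]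
    simp only
    rw [Complex.norm_exp_I_mul_ofReal, mul_one, Complex.norm_real, Real.norm_eq_abs, abs_sub_comm,
      abs_of_nonneg (sub_nonneg.2 (hanti (Nat.le_succ k)))]
  · rw [norm_mul, Complex.norm_real, Real.norm_of_nonneg hg0]
    have hG : 0 ≤ ρ 0 * Real.exp (-D.freq 0 * σ') := mul_nonneg (hρ _) (Real.exp_nonneg _)
    calc g (k + 1) * ‖e (k + 1) - e k‖
        ≤ (ρ 0 * Real.exp (-D.freq 0 * σ') * Real.exp (-ε * D.freq (k + 1))) *
            (|s.im| * (D.freq (k + 1) - D.freq k)) :=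
          mul_le_mul (mul_exp_le_of_add_le hρ hanti' hs _) hstep (norm_nonneg _) (by positivity)
      _ = |s.im| * (ρ 0 * Real.exp (-D.freq 0 * σ')) *
            (Real.exp (-ε * D.freq (k + 1)) * (D.freq (k + 1) - D.freq k)) := by ring
      _ ≤ |s.im| * (ρ 0 * Real.exp (-D.freq 0 * σ')) *
            ((Real.exp (-ε * D.freq k) - Real.exp (-ε * D.freq (k + 1))) / ε) :=
          mul_le_mul_of_nonneg_left (D.exp_mul_freq_sub_le hε k) (by positivity)
      _ = _ := by ring

/-- Summing by parts against the powers of `exp(iω)`, whose sums are bounded, gives a bound for the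
blocks of the series that is linear in `|Im s|` and decays with the starting index. -/
theorem norm_partialSum_add_sub_le
    (hcoeff : ∀ n, D.coeff n = ρ n * Complex.exp (Complex.I * ω) ^ (n + 1))
    (hω : Complex.exp (Complex.I * ω) ≠ 1) (hρ : ∀ n, 0 ≤ ρ n) {σ' ε : ℝ} {s : ℂ} (hε : 0 < ε)
    (hanti' : Antitone fun n => ρ n * Real.exp (-D.freq n * σ'))
    (hanti : Antitone fun n => ρ n * Real.exp (-D.freq n * s.re)) (hs : σ' + ε ≤ s.re)
    (M n : ℕ) :
    ‖D.partialSum (M + n) s - D.partialSum M s‖ ≤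
      2 / ‖Complex.exp (Complex.I * ω) - 1‖ * (ρ 0 * Real.exp (-D.freq 0 * σ')) *
        (1 + |s.im| / ε) * Real.exp (-ε * D.freq M) := by
  set z := Complex.exp (Complex.I * ω)
  have hz1 : ‖z‖ = 1 := Complex.norm_exp_I_mul_ofReal ω
  set G := ρ 0 * Real.exp (-D.freq 0 * σ')
  have hG : 0 ≤ G := mul_nonneg (hρ _) (Real.exp_nonneg _)
  set b : ℕ → ℂ := fun k => (ρ (M + k) : ℂ) * Complex.exp (-(D.freq (M + k) : ℂ) * s) with hb
  have hbnorm : ∀ k, ‖b k‖ = ρ (M + k) * Real.exp (-D.freq (M + k) * s.re) := by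
    intro k
    rw [hb]
    simp only
    rw [norm_mul, Complex.norm_real, Real.norm_of_nonneg (hρ _), Complex.norm_exp]
    simp
  have hfac : D.partialSum (M + n) s - D.partialSum M s =
      z ^ (M + 1) * ∑ k ∈ Finset.range n, z ^ k * b k := by
    rw [partialSum_add_sub, Finset.mul_sum]
    refine Finset.sum_congr rfl fun k _ => ?_
    rw [hcoeff, hb]
    ring
  rw [hfac, norm_mul, norm_pow, hz1, one_pow, one_mul]
  refine (norm_sum_range_mul_le_of_bounded
    (norm_geom_sum_le_of_norm_eq_one hz1 hω) n).trans ?_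
  rw [mul_assoc, mul_assoc]
  refine mul_le_mul_of_nonneg_left ?_ (by positivity)
  have hvar : ∑ k ∈ Finset.range n, ‖b (k + 1) - b k‖ ≤ (‖b 0‖ - ‖b n‖) +
      |s.im| * G / ε * (Real.exp (-ε * D.freq M) - Real.exp (-ε * D.freq (M + n))) := by
    refine (Finset.sum_le_sum fun k _ =>
      norm_term_succ_sub_le hρ hε hanti' hanti hs (M + k)).trans_eq ?_
    simp only [add_assoc M]
    rw [Finset.sum_add_distrib, ← Finset.mul_sum,
      Finset.sum_range_sub' (fun k => Real.exp (-ε * D.freq (M + k))),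
      Finset.sum_range_sub' (fun k => ρ (M + k) * Real.exp (-D.freq (M + k) * s.re)),
      hbnorm, hbnorm, add_zero]
  have hb0 : ‖b 0‖ ≤ G * Real.exp (-ε * D.freq M) := by
    rw [hbnorm, add_zero]
    exact mul_exp_le_of_add_le hρ hanti' hs M
  have hneg : 0 ≤ |s.im| * G / ε * Real.exp (-ε * D.freq (M + n)) := by positivity
  calc ‖b n‖ + ∑ k ∈ Finset.range n, ‖b (k + 1) - b k‖
      ≤ G * Real.exp (-ε * D.freq M) + |s.im| * G / ε * Real.exp (-ε * D.freq M) := by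
        linarith
    _ = _ := by ring

/-- Once `t` times the current gap of the frequencies is at most `δ`, the blocks of the series are
bounded without any loss in `t = Im s`: the increments `ω - t (λ(k+1) - λ(k))` of the phase stay
within `δ` of `ω`, whereas `exp(iω)` is at distance at least `2δ` from `1`. -/
theorem norm_partialSum_add_sub_le_of_mul_gap_le
    (hcoeff : ∀ n, D.coeff n = ρ n * Complex.exp (Complex.I * ω) ^ (n + 1)) (hρ : ∀ n, 0 ≤ ρ n)
    (hgap : Antitone fun n => D.freq (n + 1) - D.freq n) {δ : ℝ} (hδ : 0 < δ)
    (hδω : 2 * δ ≤ ‖Complex.exp (Complex.I * ω) - 1‖) {s : ℂ}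
    (hanti : Antitone fun n => ρ n * Real.exp (-D.freq n * s.re)) (ht : 0 ≤ s.im) {M : ℕ}
    (hM : s.im * (D.freq (M + 1) - D.freq M) ≤ δ) (n : ℕ) :
    ‖D.partialSum (M + n) s - D.partialSum M s‖ ≤
      4 / δ * (ρ M * Real.exp (-D.freq M * s.re)) := by
  set φ : ℕ → ℝ := fun k => ω * k - s.im * D.freq (M + k) with hφ
  have hstep : ∀ k, φ (k + 1) - φ k = ω - s.im * (D.freq (M + k + 1) - D.freq (M + k)) := by
    intro k
    rw [hφ]
    simp only
    rw [← add_assoc]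
    push_cast
    ring
  have hgap0 : ∀ k, 0 ≤ s.im * (D.freq (M + k + 1) - D.freq (M + k)) := fun k =>
    mul_nonneg ht (sub_nonneg.2 (D.freq_strictMono.monotone (Nat.le_succ _)))
  have hgapM : ∀ k, s.im * (D.freq (M + k + 1) - D.freq (M + k)) ≤ δ := fun k =>
    (mul_le_mul_of_nonneg_left (hgap (Nat.le_add_right M k)) ht).trans hM
  have hlow : ∀ k, δ ≤ ‖Complex.exp (Complex.I * ((φ (k + 1) - φ k : ℝ) : ℂ)) - 1‖ := by
    intro k
    have h1 := norm_exp_I_mul_sub_exp_I_mul_le ω (φ (k + 1) - φ k)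
    rw [hstep, sub_sub_cancel, abs_of_nonneg (hgap0 k)] at h1
    have h2 := norm_sub_le_norm_sub_add_norm_sub (Complex.exp (Complex.I * ω))
      (Complex.exp (Complex.I * ((φ (k + 1) - φ k : ℝ) : ℂ))) 1
    rw [hstep] at h2 ⊢
    have := hgapM k
    linarith
  have hmono : Monotone fun k => φ (k + 1) - φ k := by
    intro i j hij
    simp only [hstep]
    exact sub_le_sub_left (mul_le_mul_of_nonneg_left (hgap (Nat.add_le_add_left hij M)) ht) _
  have hR : ∀ k, (φ (k + 1) - φ k) - (φ 1 - φ 0) ≤ δ := by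
    intro k
    rw [hstep, hstep 0]
    have h1 := hgap0 k
    have h2 := hgapM 0
    linarith
  set g : ℕ → ℝ := fun k => ρ (M + k) * Real.exp (-D.freq (M + k) * s.re) with hg
  have hganti : Antitone g := fun i j hij => hanti (Nat.add_le_add_left hij M)
  have hg0 : 0 ≤ g n := mul_nonneg (hρ _) (Real.exp_nonneg _)
  have hfac : D.partialSum (M + n) s - D.partialSum M s =
      Complex.exp (Complex.I * ω) ^ (M + 1) *
        ∑ k ∈ Finset.range n, Complex.exp (Complex.I * φ k) * (g k : ℂ) := by
    rw [partialSum_add_sub, Finset.mul_sum]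
    refine Finset.sum_congr rfl fun k _ => ?_
    have h1 : Complex.exp (Complex.I * φ k) = Complex.exp (Complex.I * ω) ^ k *
        Complex.exp (Complex.I * ((-(s.im * D.freq (M + k)) : ℝ) : ℂ)) := by
      rw [← Complex.exp_nat_mul, ← Complex.exp_add, hφ]
      push_cast
      ring_nf
    rw [hcoeff, exp_neg_freq_mul, h1, hg]
    push_cast
    ring
  rw [hfac, norm_mul, norm_pow, Complex.norm_exp_I_mul_ofReal, one_pow, one_mul]
  refine (norm_sum_range_mul_le_of_bounded
    (norm_sum_range_exp_le hδ hlow hmono hR) n).trans_eq ?_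
  have hvar : ∑ k ∈ Finset.range n, ‖(g (k + 1) : ℂ) - (g k : ℂ)‖ = g 0 - g n := by
    rw [← Finset.sum_range_sub']
    refine Finset.sum_congr rfl fun k _ => ?_
    rw [← Complex.ofReal_sub, Complex.norm_real, Real.norm_eq_abs, abs_sub_comm,
      abs_of_nonneg (sub_nonneg.2 (hganti (Nat.le_succ k)))]
  rw [hvar, Complex.norm_real, Real.norm_of_nonneg hg0, add_sub_cancel, hg]
  simp only [add_zero]
  field_simp
  ring

theorem tendsto_const_mul_exp_neg_freq (D : GeneralDirichletSeries) {ε : ℝ} (hε : 0 < ε)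
    (K : ℝ) : Tendsto (fun M => K * Real.exp (-ε * D.freq M)) atTop (𝓝 0) := by
  have h := (Real.tendsto_exp_atBot.comp
    (D.freq_tendsto.const_mul_atTop_of_neg (neg_lt_zero.2 hε))).const_mul K
  rwa [mul_zero] at h

theorem exists_convergesTo
    (hcoeff : ∀ n, D.coeff n = ρ n * Complex.exp (Complex.I * ω) ^ (n + 1))
    (hω : Complex.exp (Complex.I * ω) ≠ 1) (hρ : ∀ n, 0 ≤ ρ n)
    (hanti : ∀ σ, σ₀ < σ → Antitone fun n => ρ n * Real.exp (-D.freq n * σ))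
    {s : ℂ} (hs : σ₀ < s.re) : ∃ l, D.ConvergesTo s l := by
  obtain ⟨σ', hσ', hσs⟩ := exists_between hs
  have hε : 0 < s.re - σ' := sub_pos.2 hσs
  refine cauchySeq_tendsto_of_complete (cauchySeq_of_le_tendsto_0' (fun M => 2 /
    ‖Complex.exp (Complex.I * ω) - 1‖ * (ρ 0 * Real.exp (-D.freq 0 * σ')) *
      (1 + |s.im| / (s.re - σ')) * Real.exp (-(s.re - σ') * D.freq M)) (fun M N hMN => ?_) ?_)
  · obtain ⟨n, rfl⟩ := Nat.exists_eq_add_of_le hMN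
    rw [dist_comm, dist_eq_norm]
    exact norm_partialSum_add_sub_le hcoeff hω hρ hε (hanti _ hσ') (hanti _ hs) (by linarith) M n
  · exact D.tendsto_const_mul_exp_neg_freq hε _

theorem norm_sub_partialSum_le
    (hcoeff : ∀ n, D.coeff n = ρ n * Complex.exp (Complex.I * ω) ^ (n + 1))
    (hω : Complex.exp (Complex.I * ω) ≠ 1) (hρ : ∀ n, 0 ≤ ρ n)
    (hanti : ∀ σ, σ₀ < σ → Antitone fun n => ρ n * Real.exp (-D.freq n * σ))
    {f : ℂ → ℂ} (hf : ∀ s : ℂ, σ₀ < s.re → D.ConvergesTo s (f s)) {σ₁ : ℝ} (hσ₁ : σ₀ < σ₁) :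
    ∃ K ε : ℝ, 0 ≤ K ∧ 0 < ε ∧ ∀ s : ℂ, σ₁ ≤ s.re → ∀ M,
      ‖f s - D.partialSum M s‖ ≤ K * (1 + |s.im| / ε) * Real.exp (-ε * D.freq M) := by
  obtain ⟨σ', hσ', hσ1⟩ := exists_between hσ₁
  refine ⟨2 / ‖Complex.exp (Complex.I * ω) - 1‖ * (ρ 0 * Real.exp (-D.freq 0 * σ')), σ₁ - σ',
    mul_nonneg (by positivity) (mul_nonneg (hρ 0) (Real.exp_nonneg _)), sub_pos.2 hσ1,
    fun s hs M => (hf s (hσ₁.trans_le hs)).norm_sub_partialSum_le fun n => ?_⟩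
  exact norm_partialSum_add_sub_le hcoeff hω hρ (sub_pos.2 hσ1) (hanti _ hσ')
    (hanti _ (hσ₁.trans_le hs)) (by linarith) M n

theorem differentiableOn_of_convergesTo
    (hcoeff : ∀ n, D.coeff n = ρ n * Complex.exp (Complex.I * ω) ^ (n + 1))
    (hω : Complex.exp (Complex.I * ω) ≠ 1) (hρ : ∀ n, 0 ≤ ρ n)
    (hanti : ∀ σ, σ₀ < σ → Antitone fun n => ρ n * Real.exp (-D.freq n * σ))
    {f : ℂ → ℂ} (hf : ∀ s : ℂ, σ₀ < s.re → D.ConvergesTo s (f s)) :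
    DifferentiableOn ℂ f {s : ℂ | σ₀ < s.re} := by
  have hU : IsOpen {s : ℂ | σ₀ < s.re} := isOpen_lt continuous_const Complex.continuous_re
  refine TendstoLocallyUniformlyOn.differentiableOn (F := D.partialSum) (φ := atTop) ?_
    (Eventually.of_forall fun N => (D.differentiable_partialSum N).differentiableOn) hU
  rw [Metric.tendstoLocallyUniformlyOn_iff]
  intro η hη x hx
  obtain ⟨σ₁, hσ₁, hσx⟩ := exists_between (show σ₀ < x.re from hx)
  obtain ⟨K, ε, hK, hε, hbound⟩ := norm_sub_partialSum_le hcoeff hω hρ hanti hf hσ₁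
  refine ⟨{s | σ₁ < s.re ∧ |s.im| < |x.im| + 1}, mem_nhdsWithin_of_mem_nhds ?_, ?_⟩
  · refine ((isOpen_lt continuous_const Complex.continuous_re).inter
      (isOpen_lt Complex.continuous_im.abs continuous_const)).mem_nhds ⟨hσx, ?_⟩
    exact lt_add_one |x.im|
  · have hlim : Tendsto (fun M => K * (1 + (|x.im| + 1) / ε) * Real.exp (-ε * D.freq M)) atTop
        (𝓝 0) := D.tendsto_const_mul_exp_neg_freq hε _
    filter_upwards [hlim.eventually_lt_const hη] with M hM s hs
    rw [dist_eq_norm]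
    refine (hbound s hs.1.le M).trans_lt (lt_of_le_of_lt ?_ hM)
    have := hs.2.le
    gcongr

theorem exists_norm_le_add_rpow
    (hcoeff : ∀ n, D.coeff n = ρ n * Complex.exp (Complex.I * ω) ^ (n + 1))
    (hω : Complex.exp (Complex.I * ω) ≠ 1) (hρ : ∀ n, 0 ≤ ρ n)
    (hanti : ∀ σ, σ₀ < σ → Antitone fun n => ρ n * Real.exp (-D.freq n * σ))
    {f : ℂ → ℂ} (hf : ∀ s : ℂ, σ₀ < s.re → D.ConvergesTo s (f s)) {σ₁ : ℝ} (hσ₁ : σ₀ < σ₁) :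
    ∃ A B : ℝ, 0 < A ∧ 0 < B ∧ ∀ s : ℂ, σ₁ ≤ s.re → ‖f s‖ ≤ A + |s.im| ^ B := by
  obtain ⟨K, ε, hK, hε, hbound⟩ := norm_sub_partialSum_le hcoeff hω hρ hanti hf hσ₁
  refine ⟨K + (K / ε) ^ 2 + 1, 2, by positivity, two_pos, fun s hs => ?_⟩
  have h1 := hbound s hs 0
  rw [partialSum, Finset.sum_range_zero, sub_zero] at h1
  have h2 : Real.exp (-ε * D.freq 0) ≤ 1 :=
    Real.exp_le_one_iff.2 (by nlinarith [mul_nonneg hε.le (D.freq_nonneg 0)])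
  have h3 : ‖f s‖ ≤ K * (1 + |s.im| / ε) := h1.trans (mul_le_of_le_one_right (by positivity) h2)
  have h4 : K * (1 + |s.im| / ε) = K + K / ε * |s.im| := by ring
  rw [Real.rpow_two]
  -- The exponent `2` is not sharp: it absorbs the constant `K / ε` in front of `|s.im|`.
  nlinarith [sq_nonneg (K / ε - |s.im|), sq_nonneg (K / ε), sq_nonneg |s.im|]

/-! ### Bounded mean squares on vertical lines -/

theorem mul_dist_le_abs_freq_sub {η : ℝ} {N : ℕ}
    (hN : ∀ k < N, η ≤ D.freq (k + 1) - D.freq k) {m n : ℕ} (hm : m < N) (hn : n < N) :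
    η * Nat.dist m n ≤ |D.freq m - D.freq n| := by
  have key : ∀ m d : ℕ, m + d < N → η * d ≤ D.freq (m + d) - D.freq m := by
    intro m d
    induction d with
    | zero => simp
    | succ d ih =>
      intro h
      have h1 := ih (by omega)
      have h2 := hN (m + d) (by omega)
      push_cast
      rw [← add_assoc]
      linarith
  rcases le_total m n with h | h
  · obtain ⟨d, rfl⟩ := Nat.exists_eq_add_of_le h
    rw [Nat.dist_eq_sub_of_le h, Nat.add_sub_cancel_left, abs_sub_comm]
    exact (key m d hn).trans (le_abs_self _)
  · obtain ⟨d, rfl⟩ := Nat.exists_eq_add_of_le h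
    rw [Nat.dist_eq_sub_of_le_right h, Nat.add_sub_cancel_left]
    exact (key n d hm).trans (le_abs_self _)

/-- The mean squares on vertical segments of length `T` are bounded for all `T > 0` at once, as the
point where the series is cut depends on `T`. -/
theorem exists_meanSquare_le
    (hcoeff : ∀ n, D.coeff n = ρ n * Complex.exp (Complex.I * ω) ^ (n + 1))
    (hω : Complex.exp (Complex.I * ω) ≠ 1) (hρ : ∀ n, 0 ≤ ρ n)
    (hanti : ∀ σ, σ₀ < σ → Antitone fun n => ρ n * Real.exp (-D.freq n * σ))
    (hgap : Antitone fun n => D.freq (n + 1) - D.freq n)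
    (hgap0 : Tendsto (fun n => D.freq (n + 1) - D.freq n) atTop (𝓝 0))
    {f : ℂ → ℂ} (hf : ∀ s : ℂ, σ₀ < s.re → D.ConvergesTo s (f s)) {σ₁ : ℝ} (hσ₁ : σ₀ < σ₁)
    (hsum : Summable fun n => (ρ n * Real.exp (-D.freq n * σ₁)) ^ 2) :
    ∃ C : ℝ, ∀ σ, σ₁ ≤ σ → ∀ T : ℝ, 0 < T →
      (1 / T) * ∫ t in (0 : ℝ)..T, ‖f ((σ : ℂ) + (t : ℂ) * Complex.I)‖ ^ 2 ≤ C := by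
  set δ := ‖Complex.exp (Complex.I * ω) - 1‖ / 2 with hδdef
  have hδ : 0 < δ := half_pos (norm_pos_iff.2 (sub_ne_zero.2 hω))
  set c : ℕ → ℝ := fun n => ρ n * Real.exp (-D.freq n * σ₁) with hc
  have hc0 : ∀ n, 0 ≤ c n := fun n => mul_nonneg (hρ n) (Real.exp_nonneg _)
  set E := 4 / δ * c 0 with hE
  set Q := Real.exp 1 * (√Real.pi * (2 * (1 - Real.exp (-δ ^ 2 / 4))⁻¹ * ∑' n, c n ^ 2)) with hQ
  refine ⟨2 * Q + 2 * E ^ 2, fun σ hσ T hT => ?_⟩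
  have hσ0 : σ₀ < σ := hσ₁.trans_le hσ
  have hle : ∀ n, ρ n * Real.exp (-D.freq n * σ) ≤ c n := by
    intro n
    refine mul_le_mul_of_nonneg_left (Real.exp_le_exp.2 ?_) (hρ n)
    nlinarith [mul_le_mul_of_nonneg_left hσ (D.freq_nonneg n)]
  have hex : ∃ N, T * (D.freq (N + 1) - D.freq N) ≤ δ := by
    have h1 := hgap0.const_mul T
    rw [mul_zero] at h1
    exact (h1.eventually_le_const hδ).exists
  classical
  set N := Nat.find hex
  have hN : T * (D.freq (N + 1) - D.freq N) ≤ δ := Nat.find_spec hex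
  have hmin : ∀ k < N, δ / T ≤ D.freq (k + 1) - D.freq k := by
    intro k hk
    have h1 := Nat.find_min hex hk
    rw [not_le] at h1
    rw [div_le_iff₀' hT]
    exact h1.le
  -- From `N` on the phase is nearly `ω n`, and cancellation alone suffices.
  have htail : ∀ t ∈ Set.Icc 0 T, ‖f ((σ : ℂ) + (t : ℂ) * Complex.I) -
      D.partialSum N ((σ : ℂ) + (t : ℂ) * Complex.I)‖ ≤ E := by
    intro t ht
    have hre : ((σ : ℂ) + (t : ℂ) * Complex.I).re = σ := by simp
    have him : ((σ : ℂ) + (t : ℂ) * Complex.I).im = t := by simp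
    refine (hf _ (by rwa [hre])).norm_sub_partialSum_le fun n => ?_
    refine (norm_partialSum_add_sub_le_of_mul_gap_le hcoeff hρ hgap hδ (by rw [hδdef]; linarith)
      (by rw [hre]; exact hanti σ hσ0) (by rw [him]; exact ht.1) (M := N) ?_ n).trans ?_
    · rw [him]
      refine (mul_le_mul_of_nonneg_right ht.2 ?_).trans hN
      exact sub_nonneg.2 (D.freq_strictMono.monotone (Nat.le_succ _))
    · rw [hre, hE]
      exact mul_le_mul_of_nonneg_left
        ((hle N).trans (hanti σ₁ hσ₁ (Nat.zero_le N))) (by positivity)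
  -- Below `N` the frequencies are separated by `δ / T`, and the terms are nearly orthogonal.
  have hhead : ∫ t in (0 : ℝ)..T, ‖D.partialSum N ((σ : ℂ) + (t : ℂ) * Complex.I)‖ ^ 2 ≤
      T * Q := by
    have h1 : ∀ t : ℝ, D.partialSum N ((σ : ℂ) + (t : ℂ) * Complex.I) =
        ∑ n ∈ Finset.range N, (D.coeff n * (Real.exp (-D.freq n * σ) : ℂ)) *
          Complex.exp (Complex.I * ((-D.freq n : ℝ) : ℂ) * t) := by
      intro t
      rw [partialSum]
      refine Finset.sum_congr rfl fun n _ => ?_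
      rw [Complex.ofReal_exp, mul_assoc, ← Complex.exp_add]
      push_cast
      ring_nf
    have h2 : ∀ n, ‖D.coeff n * (Real.exp (-D.freq n * σ) : ℂ)‖ ≤ c n := by
      intro n
      rw [hcoeff, norm_mul, norm_mul, norm_pow, Complex.norm_exp_I_mul_ofReal, one_pow, mul_one,
        Complex.norm_real, Complex.norm_real, Real.norm_of_nonneg (hρ n),
        Real.norm_of_nonneg (Real.exp_nonneg _)]
      exact hle n
    simp only [h1]
    refine (intervalIntegral_norm_sq_exp_sum_le hδ hT hc0 h2 (μ := fun n => -D.freq n)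
      fun m hm n hn => ?_).trans ?_
    · have h3 := mul_dist_le_abs_freq_sub hmin hm hn
      rw [div_mul_eq_mul_div, div_le_iff₀' hT] at h3
      rwa [neg_sub_neg, abs_sub_comm]
    · have h4 : Real.exp (-δ ^ 2 / 4) ≤ 1 := Real.exp_le_one_iff.2 (by nlinarith [sq_nonneg δ])
      have h5 : 0 ≤ (1 - Real.exp (-δ ^ 2 / 4))⁻¹ := inv_nonneg.2 (sub_nonneg.2 h4)
      have h6 := hsum.sum_le_tsum (Finset.range N) fun n _ => sq_nonneg (c n)
      calc _ ≤ Real.exp 1 * (√Real.pi * T *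
            (2 * (1 - Real.exp (-δ ^ 2 / 4))⁻¹ * ∑' n, c n ^ 2)) := by gcongr
        _ = T * Q := by rw [hQ]; ring
  have hcont : Continuous fun t : ℝ => f ((σ : ℂ) + (t : ℂ) * Complex.I) := by
    refine (differentiableOn_of_convergesTo hcoeff hω hρ hanti hf).continuousOn.comp_continuous
      (by fun_prop) fun t => ?_
    simpa using hσ0
  have hcontP : Continuous fun t : ℝ => D.partialSum N ((σ : ℂ) + (t : ℂ) * Complex.I) :=
    (D.differentiable_partialSum N).continuous.comp (by fun_prop)
  have hcontf2 : Continuous fun t : ℝ => ‖f ((σ : ℂ) + (t : ℂ) * Complex.I)‖ ^ 2 :=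
    hcont.norm.pow 2
  have hcontP2 : Continuous fun t : ℝ =>
      2 * ‖D.partialSum N ((σ : ℂ) + (t : ℂ) * Complex.I)‖ ^ 2 :=
    (hcontP.norm.pow 2).const_mul 2
  have hI : ∫ t in (0 : ℝ)..T, ‖f ((σ : ℂ) + (t : ℂ) * Complex.I)‖ ^ 2 ≤
      2 * (T * Q) + T * (2 * E ^ 2) := by
    calc _ ≤ ∫ t in (0 : ℝ)..T,
          (2 * ‖D.partialSum N ((σ : ℂ) + (t : ℂ) * Complex.I)‖ ^ 2 + 2 * E ^ 2) := by
          refine intervalIntegral.integral_mono_on hT.le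
            (hcontf2.intervalIntegrable _ _)
            ((hcontP2.add continuous_const).intervalIntegrable _ _) fun t ht => ?_
          have h1 := htail t ht
          have h2 := norm_le_norm_add_norm_sub' (f ((σ : ℂ) + (t : ℂ) * Complex.I))
            (D.partialSum N ((σ : ℂ) + (t : ℂ) * Complex.I))
          have h3 := pow_le_pow_left₀ (norm_nonneg _) (h2.trans (add_le_add_right h1 _)) 2
          nlinarith [sq_nonneg (‖D.partialSum N ((σ : ℂ) + (t : ℂ) * Complex.I)‖ - E)]
      _ = 2 * (∫ t in (0 : ℝ)..T, ‖D.partialSum N ((σ : ℂ) + (t : ℂ) * Complex.I)‖ ^ 2) +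
          T * (2 * E ^ 2) := by
          rw [intervalIntegral.integral_add (hcontP2.intervalIntegrable _ _)
            (continuous_const.intervalIntegrable _ _),
            intervalIntegral.integral_const_mul, intervalIntegral.integral_const, sub_zero,
            smul_eq_mul]
      _ ≤ _ := by gcongr
  rw [one_div, inv_mul_le_iff₀ hT]
  linarith

/-! ### The hypotheses on the coefficients and the frequencies -/

theorem summable_of_sigmaTwo_lt {σ : ℝ} (h : D.sigmaTwo < (σ : EReal)) :
    Summable fun n => ‖D.coeff n‖ ^ 2 * Real.exp (-2 * D.freq n * σ) := by
  obtain ⟨x, ⟨τ, hτ, rfl⟩, hx⟩ := sInf_lt_iff.1 h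
  have hτσ : τ < σ := EReal.coe_lt_coe_iff.1 hx
  refine Summable.of_nonneg_of_le (fun n => by positivity) (fun n => ?_) hτ
  refine mul_le_mul_of_nonneg_left (Real.exp_le_exp.2 ?_) (sq_nonneg _)
  nlinarith [mul_le_mul_of_nonneg_left hτσ.le (D.freq_nonneg n)]

end GeneralDirichletSeries

/-- The increment over `[n + 1, n + 2]` is a value of the derivative in that interval, so the
increments inherit its monotonicity and its limit. -/
theorem antitone_and_tendsto_increments {lam : ℝ → ℝ}
    (hsmooth : ContDiffOn ℝ 2 lam (Set.Ici 1))
    (hanti : AntitoneOn (derivWithin lam (Set.Ici 1)) (Set.Ici 1))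
    (hlim : Tendsto (derivWithin lam (Set.Ici 1)) atTop (𝓝 0)) :
    (Antitone fun n : ℕ => lam ((n : ℝ) + 1 + 1) - lam ((n : ℝ) + 1)) ∧
      Tendsto (fun n : ℕ => lam ((n : ℝ) + 1 + 1) - lam ((n : ℝ) + 1)) atTop (𝓝 0) := by
  have hdiff : DifferentiableOn ℝ lam (Set.Ici 1) := hsmooth.differentiableOn (by norm_num)
  have hmvt : ∀ n : ℕ, ∃ ξ : ℝ, (n : ℝ) + 1 < ξ ∧ ξ < n + 1 + 1 ∧
      lam ((n : ℝ) + 1 + 1) - lam ((n : ℝ) + 1) = derivWithin lam (Set.Ici 1) ξ := by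
    intro n
    have hn : (0 : ℝ) ≤ n := n.cast_nonneg
    obtain ⟨ξ, hξ, h⟩ := exists_deriv_eq_slope lam (lt_add_one ((n : ℝ) + 1))
      (hdiff.continuousOn.mono fun x hx => by
        simp only [Set.mem_Ici]
        linarith [hx.1])
      (hdiff.mono fun x hx => by
        simp only [Set.mem_Ici]
        linarith [hx.1])
    refine ⟨ξ, hξ.1, hξ.2, ?_⟩
    rw [derivWithin_of_mem_nhds (Ici_mem_nhds (by linarith [hξ.1])), h, add_sub_cancel_left,
      div_one]
  choose ξ h1 h2 h3 using hmvt
  have hmem : ∀ n, ξ n ∈ Set.Ici (1 : ℝ) := fun n => by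
    have hn : (0 : ℝ) ≤ n := n.cast_nonneg
    simp only [Set.mem_Ici]
    linarith [h1 n]
  simp only [h3]
  refine ⟨antitone_nat_of_succ_le fun n => hanti (hmem _) (hmem _) ?_, hlim.comp ?_⟩
  · have := h1 (n + 1)
    push_cast at this
    linarith [h2 n]
  · refine tendsto_atTop_mono (fun n => ?_) tendsto_natCast_atTop_atTop
    linarith [h1 n]

theorem theorem4p2 (σ₀ : ℝ) (D : GeneralDirichletSeries) (lam rho : ℝ → ℝ) (omega : ℝ)
    (hfreq : ∀ n : ℕ, D.freq n = lam ((n : ℝ) + 1))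
    (hcoeff : ∀ n : ℕ, D.coeff n =
      (rho ((n : ℝ) + 1) : ℂ) * Complex.exp (Complex.I * (omega : ℂ) * ((n : ℂ) + 1)))
    (hsigmaTwo : D.sigmaTwo ≤ (σ₀ : EReal))
    (homega : ∀ k : ℤ, omega ≠ 2 * Real.pi * (k : ℝ))
    (hlam_nonneg : ∀ x ∈ Set.Ici (1 : ℝ), 0 ≤ lam x)
    (hrho_nonneg : ∀ x ∈ Set.Ici (1 : ℝ), 0 ≤ rho x)
    (hlam_smooth : ContDiffOn ℝ 2 lam (Set.Ici 1))
    (hrho_smooth : ContDiffOn ℝ 2 rho (Set.Ici 1))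
    (hlam_mono : StrictMonoOn lam (Set.Ici 1))
    (hlam_tendsto : Tendsto lam atTop atTop)
    (hlam'_anti : AntitoneOn (derivWithin lam (Set.Ici 1)) (Set.Ici 1))
    (hlam'_tendsto : Tendsto (derivWithin lam (Set.Ici 1)) atTop (𝓝 0))
    (hanti : ∀ σ : ℝ, σ₀ < σ →
      AntitoneOn (fun x : ℝ => rho x * Real.exp (-lam x * σ)) (Set.Ici 1))
    (hindep : LinearIndependent ℚ D.freq) :
    D ∈ GeneralDirichletSeries.dwa σ₀ := by
  set ρ : ℕ → ℝ := fun n => rho ((n : ℝ) + 1)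
  have hmem : ∀ n : ℕ, (n : ℝ) + 1 ∈ Set.Ici (1 : ℝ) := fun n => by simp
  have hcoeff' : ∀ n, D.coeff n = ρ n * Complex.exp (Complex.I * omega) ^ (n + 1) := by
    intro n
    rw [hcoeff, ← Complex.exp_nat_mul, mul_comm ((n + 1 : ℕ) : ℂ)]
    push_cast
    rfl
  have hω : Complex.exp (Complex.I * omega) ≠ 1 := by
    intro h
    obtain ⟨k, hk⟩ := Complex.exp_eq_one_iff.1 h
    refine homega k (Complex.ofReal_injective (mul_left_cancel₀ Complex.I_ne_zero ?_))
    rw [hk]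
    push_cast
    ring
  have hρ : ∀ n, 0 ≤ ρ n := fun n => hrho_nonneg _ (hmem n)
  have hanti' : ∀ σ, σ₀ < σ → Antitone fun n => ρ n * Real.exp (-D.freq n * σ) := by
    intro σ hσ m n hmn
    simp only [hfreq]
    exact hanti σ hσ (hmem m) (hmem n) (by gcongr)
  have hgap := antitone_and_tendsto_increments hlam_smooth hlam'_anti hlam'_tendsto
  have hinc : ∀ n : ℕ, lam ((n : ℝ) + 1 + 1) - lam ((n : ℝ) + 1) = D.freq (n + 1) - D.freq n := by
    intro n
    rw [hfreq, hfreq]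
    push_cast
    rfl
  simp only [hinc] at hgap
  choose! f hf using fun (s : ℂ) (hs : σ₀ < s.re) =>
    GeneralDirichletSeries.exists_convergesTo hcoeff' hω hρ hanti' hs
  refine ⟨?_, ⟨f, ⟨?_, fun s hs _ => hf s hs⟩, fun σ₁ hσ₁ => ?_, fun σ₁ σ₂ hσ₁ _ => ?_⟩,
    hsigmaTwo, hindep⟩
  · have hs : σ₀ < (((σ₀ + 1 : ℝ) : ℂ)).re := by simp
    have hle : D.sigmaC ≤ ((((σ₀ + 1 : ℝ) : ℂ).re : ℝ) : EReal) :=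
      sInf_le ⟨_, ⟨_, hf _ hs⟩, rfl⟩
    exact hle.trans_lt (EReal.coe_lt_top _)
  · exact GeneralDirichletSeries.differentiableOn_of_convergesTo hcoeff' hω hρ hanti' hf
  · exact GeneralDirichletSeries.exists_norm_le_add_rpow hcoeff' hω hρ hanti' hf hσ₁
  · have hsum : Summable fun n => (ρ n * Real.exp (-D.freq n * σ₁)) ^ 2 := by
      refine (GeneralDirichletSeries.summable_of_sigmaTwo_lt
        (hsigmaTwo.trans_lt (EReal.coe_lt_coe_iff.2 hσ₁))).congr fun n => ?_
      rw [hcoeff', norm_mul, norm_pow, Complex.norm_exp_I_mul_ofReal, one_pow, mul_one,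
        Complex.norm_real, Real.norm_of_nonneg (hρ n), mul_pow, ← Real.exp_nat_mul]
      push_cast
      ring_nf
    obtain ⟨C, hC⟩ := GeneralDirichletSeries.exists_meanSquare_le hcoeff' hω hρ hanti'
      hgap.1 hgap.2 hf hσ₁ hsum
    exact ⟨C, fun σ hσ T hT => hC σ hσ.1 T hT⟩
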